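/- Let $\mathbf M$ be the set of Borel probability measures $\mu$ on $\mathbb R_+=[0,\infty)$ whose mean $m_\mu=\int x\,d\mu(x)$ satisfies $0<m_\mu<\infty$. For a Borel probability measure $\mu$ on $\mathbb R_+$ let $F_\mu(x)=\mu([0,x])$ and $Q_\mu(p)=\min\{q\ge 0: F_\mu(q)\ge p\}$ for $0\le p<1$; let $\mathrm W_1(\mu,\nu)=\int_0^1|Q_\mu(t)-Q_\nu(t)|\,dt$. For $\mu\in\mathbf M$ let $$L_\mu(p)=\frac{\int_0^pQ_\mu(t)\,dt}{\int_0^1Q_\mu(t)\,dt}\quad(0\le p\le 1),\qquad G(\mu)=\frac{\mathbf E|X-X'|}{2m_\mu},\qquad H(\mu)=\frac{\mathbf E|X-m_\mu|}{2m_\mu},$$ where $X,X'$ are independent with law $\mu$ (Lorenz function, Gini index, Hoover index). Let $\mu\in\mathbf M$, let $X_1,X_2,\dots$ be i.i.d. random variables with law $\mu$, and let $\hat\mu_n=\frac1n\sum_{i=1}^n\delta_{X_i}$. Then, almost surely, $\hat\mu_n\in\mathbf M$ for all sufficiently large $n$, and, as $n\to\infty$, 1. $\mathrm W_1(\hat\mu_n,\mu)\to0$;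 2. $L_{\hat\mu_n}\to L_\mu$ uniformly on $[0,1]$; 3. $G(\hat\mu_n)\to G(\mu)$; 4. $H(\hat\mu_n)\to H(\mu)$. Equivalently, the following estimators of $G(\mu)$, $H(\mu)$ and $L_\mu(p)$ are strongly consistent, that is, they converge almost surely to $G(\mu)$, $H(\mu)$ and, uniformly in $p\in[0,1]$, to $L_\mu(p)$: $$\hat G_n=\frac{\sum_{i=1}^n\sum_{j=1}^n|X_i-X_j|}{2n\sum_{i=1}^nX_i},\qquad \hat H_n=\frac{\sum_{i=1}^n\bigl|X_i-\frac1n\sum_{j=1}^nX_j\bigr|}{2\sum_{i=1}^nX_i},\qquad \hat L_n(p)=\frac{\sum_{i=1}^{np}X^{\uparrow}_{i}}{\sum_{i=1}^nX_i},$$ where $X^\uparrow_1\le\dots\le X^\uparrow_n$ is the increasing rearrangement of $X_1,\dots,X_n$ and, for $k\in\mathbb N$ and $0\le f<1$, $\sum_{i=1}^{k+f}a_i:=f\sum_{i=1}^{k+1}a_i+(1-f)\sum_{i=1}^{k}a_i$ (the term with $f=0$ being the ordinary sum). In fact, for every $n\ge1$, $\hat G_n=G(\hat\mu_n)$, $\hat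 H_n=H(\hat\mu_n)$ and $\hat L_n(p)=L_{\hat\mu_n}(p)$ for all $p\in[0,1]$ (when $X_1=\dots=X_n=0$, every quotient involved being read as $0$). -/

import Mathlib

open MeasureTheory ProbabilityTheory Filter
open scoped NNReal ENNReal Topology

namespace Wealth

noncomputable section

/-- The mean `m_μ = ∫ x dμ(x)`, as an element of `[0, ∞]`. -/
def mean (μ : Measure ℝ≥0) : ℝ≥0∞ := ∫⁻ x, (x : ℝ≥0∞) ∂μ

/-- Membership in the class `M`: Borel probability measures on `[0, ∞)` whose mean is nonzero and
finite. -/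
structure MemM (μ : Measure ℝ≥0) : Prop where
  isProbabilityMeasure : IsProbabilityMeasure μ
  mean_pos : 0 < mean μ
  mean_lt_top : mean μ < ∞

/-- The cumulative distribution function `F_μ(x) = μ([0, x])`. -/
def cumDist (μ : Measure ℝ≥0) (x : ℝ≥0) : ℝ := μ.real (Set.Iic x)

/-- The quantile function `Q_μ(p) = min {q ≥ 0 : F_μ(q) ≥ p}`, meaningful for `p ∈ [0, 1)`
(on which the infimum is attained). -/
def quantile (μ : Measure ℝ≥0) (p : ℝ) : ℝ≥0 := sInf {q : ℝ≥0 | p ≤ cumDist μ q}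

/-- The Lorenz function `L_μ(p) = ∫_0^p Q_μ / ∫_0^1 Q_μ`, meaningful for `p ∈ [0, 1]`. -/
def lorenz (μ : Measure ℝ≥0) (p : ℝ) : ℝ :=
  (∫ t in (0 : ℝ)..p, (quantile μ t : ℝ)) / ∫ t in (0 : ℝ)..1, (quantile μ t : ℝ)

/-- The Gini coefficient `E|X - X'| / (2 m)`, where `(X, X') ∼ μ ⊗ μ`. -/
def gini (μ : Measure ℝ≥0) : ℝ :=
  (∫ z : ℝ≥0 × ℝ≥0, |(z.1 : ℝ) - (z.2 : ℝ)| ∂(μ.prod μ)) / (2 * (mean μ).toReal)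

/-- The Hoover coefficient `E|X - m| / (2 m)`, where `X ∼ μ`. -/
def hoover (μ : Measure ℝ≥0) : ℝ :=
  (∫ x : ℝ≥0, |(x : ℝ) - (mean μ).toReal| ∂μ) / (2 * (mean μ).toReal)

/-- The Wasserstein-1 distance `∫_0^1 |Q_μ(t) - Q_ν(t)| dt`, as an element of `[0, ∞]`. -/
def W1 (μ ν : Measure ℝ≥0) : ℝ≥0∞ :=
  ∫⁻ t in Set.Ico (0 : ℝ) 1, ENNReal.ofReal |(quantile μ t : ℝ) - (quantile ν t : ℝ)|

/-- The empirical measure `(1/n) ∑ δ_{x_i}` of the first `n` terms of a sequence. -/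
def empirical (x : ℕ → ℝ≥0) (n : ℕ) : Measure ℝ≥0 :=
  (n : ℝ≥0∞)⁻¹ • ∑ i ∈ Finset.range n, Measure.dirac (x i)

/-- The Gini estimator `∑_i ∑_j |x_i - x_j| / (2 n ∑_i x_i)`. -/
def giniEstimator (x : ℕ → ℝ≥0) (n : ℕ) : ℝ :=
  (∑ i ∈ Finset.range n, ∑ j ∈ Finset.range n, |(x i : ℝ) - (x j : ℝ)|) /
    (2 * (n : ℝ) * ∑ i ∈ Finset.range n, (x i : ℝ))

/-- The Hoover estimator `∑_i |x_i - (1/n) ∑_j x_j| / (2 ∑_i x_i)`. -/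
def hooverEstimator (x : ℕ → ℝ≥0) (n : ℕ) : ℝ :=
  (∑ i ∈ Finset.range n, |(x i : ℝ) - (1 / (n : ℝ)) * ∑ j ∈ Finset.range n, (x j : ℝ)|) /
    (2 * ∑ i ∈ Finset.range n, (x i : ℝ))

/-- The term of index `i` (counted from `0`) of `(x 0, …, x (n - 1))` reordered increasingly;
the value is `0` beyond the sample. -/
def orderStat (x : ℕ → ℝ≥0) (n i : ℕ) : ℝ≥0 :=
  if h : i < n then x (Tuple.sort (fun j : Fin n => x j) ⟨i, h⟩) else 0

/-- The sum of the first `y` terms of `a` for a real number `y ≥ 0`, interpolated linearly between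
the integers: with `y = k + f`, `k ∈ ℕ` and `0 ≤ f < 1`, it is
`f ∑_{i < k + 1} a_i + (1 - f) ∑_{i < k} a_i`. -/
def interpSum (a : ℕ → ℝ) (y : ℝ) : ℝ :=
  (y - ⌊y⌋₊) * ∑ i ∈ Finset.range (⌊y⌋₊ + 1), a i +
    (1 - (y - ⌊y⌋₊)) * ∑ i ∈ Finset.range ⌊y⌋₊, a i

/-- The estimator of `L_μ(p)`: the (interpolated) sum of the `n p` smallest observations, divided
by the sum of all observations. -/
def lorenzEstimator (x : ℕ → ℝ≥0) (n : ℕ) (p : ℝ) : ℝ :=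
  interpSum (fun i => (orderStat x n i : ℝ)) (n * p) / ∑ i ∈ Finset.range n, (x i : ℝ)

end

end Wealth

/-! All laws are coupled through their quantile functions on `(0,1)` with uniform measure
(`map_quantile`). In this coupling the mean, the partial integrals of the quantile function and the
numerators of the Gini and Hoover indices are Lipschitz for the `L¹` distance `dist1` of quantile
functions, with constants 1, 1, 2, 2. As the limiting mean is positive, everything follows from
`dist1 → 0`.

The strong law, applied to the identity and to indicators of `[0, y]` for `y` in a countable dense
set, gives almost surely convergence of the means and of the distribution functions on that set. The
latter forces quantiles to converge off a countable set (`tendsto_quantile`); convergence of the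
means upgrades this to `L¹` by Scheffé's lemma (`tendsto_dist1`).

The estimator formulas hold because the empirical quantile function is a step function whose values
are the order statistics (`quantile_empirical`). -/

namespace Wealth

/-! ### Quantile functions and inverse transform sampling. -/

/-- The uniform distribution on the open unit interval. -/
noncomputable abbrev unif : Measure ℝ := volume.restrict (Set.Ioo (0 : ℝ) 1)

instance : IsProbabilityMeasure unif := ⟨by simp [unif]⟩

lemma cumDist_eq_cdf (μ : Measure ℝ≥0) [IsProbabilityMeasure μ] (x : ℝ≥0) :
    cumDist μ x = cdf (μ.map ((↑) : ℝ≥0 → ℝ)) x := by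
  have : IsProbabilityMeasure (μ.map ((↑) : ℝ≥0 → ℝ)) :=
    Measure.isProbabilityMeasure_map measurable_coe_nnreal_real.aemeasurable
  rw [cdf_eq_real, cumDist, map_measureReal_apply measurable_coe_nnreal_real measurableSet_Iic]
  congr 1

lemma monotone_cumDist (μ : Measure ℝ≥0) [IsProbabilityMeasure μ] : Monotone (cumDist μ) :=
  fun _ _ h => measureReal_mono (Set.Iic_subset_Iic.2 h)

/-- Right continuity of the distribution function makes the infimum attained. The bound `p < 1`
keeps the set nonempty; otherwise `sInf ∅ = 0` could break the equivalence. -/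
lemma quantile_le_iff (μ : Measure ℝ≥0) [IsProbabilityMeasure μ] {p : ℝ} (hp : p < 1)
    (x : ℝ≥0) : quantile μ p ≤ x ↔ p ≤ cumDist μ x := by
  set ν := μ.map ((↑) : ℝ≥0 → ℝ)
  refine ⟨fun h => ?_, fun h => csInf_le' h⟩
  have hne : {q : ℝ≥0 | p ≤ cumDist μ q}.Nonempty := by
    have h1 : ∀ᶠ y in atTop, p < cdf ν y := (tendsto_cdf_atTop ν).eventually_const_lt hp
    obtain ⟨y, hy, hy0⟩ := (h1.and (eventually_ge_atTop (0 : ℝ))).exists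
    lift y to ℝ≥0 using hy0
    exact ⟨y, by simpa only [Set.mem_ofPred_eq, cumDist_eq_cdf] using hy.le⟩
  have hr : Tendsto (cdf ν) (𝓝[>] (x : ℝ)) (𝓝 (cdf ν x)) :=
    ((cdf ν).right_continuous x).mono_left (nhdsWithin_mono _ Set.Ioi_subset_Ici_self)
  rw [cumDist_eq_cdf]
  refine ge_of_tendsto hr ?_
  filter_upwards [self_mem_nhdsWithin] with y (hy : (x : ℝ) < y)
  have hy0 : 0 ≤ y := x.coe_nonneg.trans hy.le
  lift y to ℝ≥0 using hy0
  obtain ⟨q, hq, hqy⟩ := exists_lt_of_csInf_lt hne (h.trans_lt (NNReal.coe_lt_coe.1 hy))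
  rw [← cumDist_eq_cdf]
  exact le_trans hq (monotone_cumDist μ hqy.le)

lemma monotoneOn_quantile (μ : Measure ℝ≥0) [IsProbabilityMeasure μ] :
    MonotoneOn (quantile μ) (Set.Ioo 0 1) := by
  intro p hp q hq h
  rw [quantile_le_iff μ hp.2]
  exact h.trans ((quantile_le_iff μ hq.2 _).1 le_rfl)

lemma aemeasurable_quantile (μ : Measure ℝ≥0) [IsProbabilityMeasure μ] :
    AEMeasurable (quantile μ) unif :=
  aemeasurable_restrict_of_monotoneOn measurableSet_Ioo (monotoneOn_quantile μ)

/-- Inverse transform sampling: the quantile function of a uniform variable has law `μ`. -/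
lemma map_quantile (μ : Measure ℝ≥0) [IsProbabilityMeasure μ] : unif.map (quantile μ) = μ := by
  have := Measure.isProbabilityMeasure_map (aemeasurable_quantile μ)
  refine Measure.ext_of_Iic _ _ fun x => ?_
  rw [Measure.map_apply_of_aemeasurable (aemeasurable_quantile μ) measurableSet_Iic,
    Measure.restrict_apply' measurableSet_Ioo, ← ofReal_measureReal (μ := μ)]
  change _ = ENNReal.ofReal (cumDist μ x)
  have h1 : cumDist μ x ≤ 1 := measureReal_le_one
  apply le_antisymm
  · rw [← sub_zero (cumDist μ x), ← Real.volume_Ioc]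
    exact measure_mono fun t ht => ⟨ht.2.1, (quantile_le_iff μ ht.2.2 x).1 ht.1⟩
  · rw [← sub_zero (cumDist μ x), ← Real.volume_Ioo]
    exact measure_mono fun t ht =>
      ⟨(quantile_le_iff μ (ht.2.trans_le h1) x).2 ht.2.le, ht.1, ht.2.trans_le h1⟩

lemma integral_comp_quantile (μ : Measure ℝ≥0) [IsProbabilityMeasure μ] {f : ℝ≥0 → ℝ}
    (hf : Measurable f) : ∫ t, f (quantile μ t) ∂unif = ∫ x, f x ∂μ := by
  conv_rhs => rw [← map_quantile μ]
  rw [integral_map (aemeasurable_quantile μ) hf.aestronglyMeasurable]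

lemma integrable_coe {μ : Measure ℝ≥0} (h : mean μ < ∞) :
    Integrable (fun x : ℝ≥0 => (x : ℝ)) μ := by
  refine ⟨measurable_coe_nnreal_real.aestronglyMeasurable, ?_⟩
  simpa [HasFiniteIntegral, mean] using h

lemma toReal_mean (μ : Measure ℝ≥0) : (mean μ).toReal = ∫ x : ℝ≥0, (x : ℝ) ∂μ := by
  rw [integral_eq_lintegral_of_nonneg_ae (ae_of_all _ fun x => x.coe_nonneg)
    measurable_coe_nnreal_real.aestronglyMeasurable]
  simp [mean]

lemma integrable_quantile {μ : Measure ℝ≥0} [IsProbabilityMeasure μ] (h : mean μ < ∞) :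
    Integrable (fun t => (quantile μ t : ℝ)) unif := by
  have h1 := integrable_coe h
  rw [← map_quantile μ] at h1
  exact h1.comp_aemeasurable (aemeasurable_quantile μ)

lemma integral_quantile (μ : Measure ℝ≥0) [IsProbabilityMeasure μ] :
    ∫ t, (quantile μ t : ℝ) ∂unif = (mean μ).toReal := by
  rw [toReal_mean, integral_comp_quantile μ measurable_coe_nnreal_real]

lemma integral_zero_one_quantile (μ : Measure ℝ≥0) [IsProbabilityMeasure μ] :
    ∫ t in (0 : ℝ)..1, (quantile μ t : ℝ) = (mean μ).toReal := by
  rw [intervalIntegral.integral_of_le zero_le_one, integral_Ioc_eq_integral_Ioo,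
    integral_quantile]

lemma intervalIntegrable_quantile {μ : Measure ℝ≥0} [IsProbabilityMeasure μ] (h : mean μ < ∞)
    {a b : ℝ} (ha : a ∈ Set.Icc (0 : ℝ) 1) (hb : b ∈ Set.Icc (0 : ℝ) 1) :
    IntervalIntegrable (fun t => (quantile μ t : ℝ)) volume a b := by
  have h1 : IntervalIntegrable (fun t => (quantile μ t : ℝ)) volume 0 1 := by
    rw [intervalIntegrable_iff_integrableOn_Ioo_of_le zero_le_one]
    exact integrable_quantile h
  refine h1.mono_set ?_
  rw [Set.uIcc_of_le zero_le_one]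
  exact Set.uIcc_subset_Icc ha hb

/-! ### Lipschitz bounds in the Wasserstein distance. -/

/-- The real-valued Wasserstein distance. -/
noncomputable def dist1 (μ ν : Measure ℝ≥0) : ℝ :=
  ∫ t, |(quantile μ t : ℝ) - (quantile ν t : ℝ)| ∂unif

section
variable {μ ν : Measure ℝ≥0} [IsProbabilityMeasure μ] [IsProbabilityMeasure ν]

lemma integrable_quantile_sub (hμ : mean μ < ∞) (hν : mean ν < ∞) :
    Integrable (fun t => |(quantile μ t : ℝ) - (quantile ν t : ℝ)|) unif :=
  ((integrable_quantile hμ).sub (integrable_quantile hν)).abs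

lemma W1_eq_ofReal_dist1 (hμ : mean μ < ∞) (hν : mean ν < ∞) :
    W1 μ ν = ENNReal.ofReal (dist1 μ ν) := by
  rw [W1, dist1, ofReal_integral_eq_lintegral_ofReal (integrable_quantile_sub hμ hν)
    (ae_of_all _ fun _ => abs_nonneg _), unif,
    restrict_Ioo_eq_restrict_Ico]

lemma abs_toReal_mean_sub_le (hμ : mean μ < ∞) (hν : mean ν < ∞) :
    |(mean μ).toReal - (mean ν).toReal| ≤ dist1 μ ν := by
  rw [← integral_quantile, ← integral_quantile, ← integral_sub (integrable_quantile hμ)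
    (integrable_quantile hν)]
  exact abs_integral_le_integral_abs

lemma abs_integral_quantile_sub_le (hμ : mean μ < ∞) (hν : mean ν < ∞) {p : ℝ}
    (hp : p ∈ Set.Icc (0 : ℝ) 1) :
    |(∫ t in (0 : ℝ)..p, (quantile μ t : ℝ)) - ∫ t in (0 : ℝ)..p, (quantile ν t : ℝ)| ≤
      dist1 μ ν := by
  have h0 : (0 : ℝ) ∈ Set.Icc (0 : ℝ) 1 := by simp
  rw [← intervalIntegral.integral_sub (intervalIntegrable_quantile hμ h0 hp)
    (intervalIntegrable_quantile hν h0 hp)]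
  refine (intervalIntegral.abs_integral_le_integral_abs hp.1).trans ?_
  rw [intervalIntegral.integral_of_le hp.1, dist1, ← integral_Ioc_eq_integral_Ioo]
  refine setIntegral_mono_set ?_ (ae_of_all _ fun _ => abs_nonneg _)
    (Set.Ioc_subset_Ioc_right hp.2).eventuallyLE
  exact (integrableOn_Ioc_iff_integrableOn_Ioo (by simp)).2 (integrable_quantile_sub hμ hν)

lemma integrable_quantile_prod (hμ : mean μ < ∞) :
    Integrable (fun z : ℝ × ℝ => |(quantile μ z.1 : ℝ) - (quantile μ z.2 : ℝ)|)
      (unif.prod unif) :=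
  (((integrable_quantile hμ).comp_fst _).sub ((integrable_quantile hμ).comp_snd _)).abs

lemma integrable_abs_sub_prod (hμ : mean μ < ∞) :
    Integrable (fun z : ℝ≥0 × ℝ≥0 => |(z.1 : ℝ) - (z.2 : ℝ)|) (μ.prod μ) :=
  (((integrable_coe hμ).comp_fst _).sub ((integrable_coe hμ).comp_snd _)).abs

/-- Fubini reduces this to inverse transform sampling in each variable separately. -/
lemma integral_abs_sub_prod (hμ : mean μ < ∞) :
    ∫ z : ℝ≥0 × ℝ≥0, |(z.1 : ℝ) - (z.2 : ℝ)| ∂(μ.prod μ) =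
      ∫ z : ℝ × ℝ, |(quantile μ z.1 : ℝ) - (quantile μ z.2 : ℝ)| ∂(unif.prod unif) := by
  have hm : Measurable (fun z : ℝ≥0 × ℝ≥0 => |(z.1 : ℝ) - (z.2 : ℝ)|) := by fun_prop
  rw [integral_prod _ (integrable_abs_sub_prod hμ), integral_prod _ (integrable_quantile_prod hμ),
    ← integral_comp_quantile μ (f := fun x => ∫ y : ℝ≥0, |(x : ℝ) - (y : ℝ)| ∂μ)
      hm.stronglyMeasurable.integral_prod_right'.measurable]
  refine integral_congr_ae (ae_of_all _ fun s => ?_)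
  exact (integral_comp_quantile μ (f := fun y => |(quantile μ s : ℝ) - (y : ℝ)|)
    (by fun_prop)).symm

lemma abs_integral_gini_sub_le (hμ : mean μ < ∞) (hν : mean ν < ∞) :
    |(∫ z : ℝ≥0 × ℝ≥0, |(z.1 : ℝ) - (z.2 : ℝ)| ∂(μ.prod μ)) -
      ∫ z : ℝ≥0 × ℝ≥0, |(z.1 : ℝ) - (z.2 : ℝ)| ∂(ν.prod ν)| ≤ 2 * dist1 μ ν := by
  have hd := integrable_quantile_sub hμ hν
  rw [integral_abs_sub_prod hμ, integral_abs_sub_prod hν,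
    ← integral_sub (integrable_quantile_prod hμ) (integrable_quantile_prod hν)]
  refine abs_integral_le_integral_abs.trans ?_
  calc _ ≤ ∫ z : ℝ × ℝ, (|(quantile μ z.1 : ℝ) - (quantile ν z.1 : ℝ)| +
        |(quantile μ z.2 : ℝ) - (quantile ν z.2 : ℝ)|) ∂(unif.prod unif) := by
        refine integral_mono ((integrable_quantile_prod hμ).sub (integrable_quantile_prod hν)).abs
          ((hd.comp_fst _).add (hd.comp_snd _)) fun z => ?_
        -- Reverse triangle inequality; each of the two coordinates then contributes one `dist1`.
        refine (abs_abs_sub_abs_le _ _).trans ?_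
        rw [sub_sub_sub_comm]
        exact abs_sub _ _
    _ = 2 * dist1 μ ν := by
        rw [integral_add (hd.comp_fst _) (hd.comp_snd _), integral_fun_fst
          (fun t => |(quantile μ t : ℝ) - (quantile ν t : ℝ)|), integral_fun_snd
          (fun t => |(quantile μ t : ℝ) - (quantile ν t : ℝ)|), ← dist1]
        simp [two_mul]

lemma abs_integral_hoover_sub_le (hμ : mean μ < ∞) (hν : mean ν < ∞) :
    |(∫ x : ℝ≥0, |(x : ℝ) - (mean μ).toReal| ∂μ) - ∫ x : ℝ≥0, |(x : ℝ) - (mean ν).toReal| ∂ν|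
      ≤ 2 * dist1 μ ν := by
  have key : ∀ {μ : Measure ℝ≥0} [IsProbabilityMeasure μ], mean μ < ∞ →
      Integrable (fun t : ℝ => |(quantile μ t : ℝ) - (mean μ).toReal|) unif := fun h =>
    ((integrable_quantile h).sub (integrable_const _)).abs
  have hd := integrable_quantile_sub hμ hν
  rw [← integral_comp_quantile μ (f := fun x => |(x : ℝ) - (mean μ).toReal|) (by fun_prop),
    ← integral_comp_quantile ν (f := fun x => |(x : ℝ) - (mean ν).toReal|) (by fun_prop),
    ← integral_sub (key hμ) (key hν)]
  refine abs_integral_le_integral_abs.trans ?_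
  -- One `dist1` comes from the quantiles, the other from the centring means.
  calc _ ≤ ∫ t, (|(quantile μ t : ℝ) - (quantile ν t : ℝ)| +
        |(mean μ).toReal - (mean ν).toReal|) ∂unif := by
        refine integral_mono ((key hμ).sub (key hν)).abs (hd.add (integrable_const _)) fun z => ?_
        refine (abs_abs_sub_abs_le _ _).trans ?_
        rw [sub_sub_sub_comm]
        exact abs_sub _ _
    _ ≤ 2 * dist1 μ ν := by
        rw [integral_add hd (integrable_const _), ← dist1, integral_const]
        simpa [two_mul] using abs_toReal_mean_sub_le hμ hν
end

/-! ### From distribution functions and means to the indices. -/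

/-- **Scheffé's lemma** for nonnegative integrable functions. -/
lemma tendsto_integral_abs_sub {α : Type*} [MeasurableSpace α] {κ : Measure α}
    {f : ℕ → α → ℝ} {g : α → ℝ} (hf0 : ∀ n x, 0 ≤ f n x) (hg0 : ∀ x, 0 ≤ g x)
    (hf : ∀ᶠ n in atTop, Integrable (f n) κ) (hg : Integrable g κ)
    (hlim : ∀ᵐ x ∂κ, Tendsto (fun n => f n x) atTop (𝓝 (g x)))
    (hint : Tendsto (fun n => ∫ x, f n x ∂κ) atTop (𝓝 (∫ x, g x ∂κ))) :
    Tendsto (fun n => ∫ x, |f n x - g x| ∂κ) atTop (𝓝 0) := by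
  -- Since `f n ≥ 0`, the positive part of `g - f n` is dominated by `g`.
  have h1 : Tendsto (fun n => ∫ x, max (g x - f n x) 0 ∂κ) atTop (𝓝 (∫ _, (0 : ℝ) ∂κ)) := by
    refine tendsto_integral_filter_of_dominated_convergence g ?_ ?_ hg ?_
    · filter_upwards [hf] with n hn
      exact ((hg.sub hn).pos_part).aestronglyMeasurable
    · refine Eventually.of_forall fun n => ae_of_all _ fun x => ?_
      rw [Real.norm_of_nonneg (le_max_right _ _)]
      exact max_le (sub_le_self _ (hf0 n x)) (hg0 x)
    · filter_upwards [hlim] with x hx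
      simpa using (tendsto_const_nhds (x := g x)).sub hx |>.max (tendsto_const_nhds (x := (0 : ℝ)))
  -- Uses `|f - g| = (f - g) + 2 (g - f)⁺`.
  have h2 := (hint.sub_const (∫ x, g x ∂κ)).add (h1.const_mul 2)
  simp only [integral_zero, mul_zero, sub_self, add_zero] at h2
  refine h2.congr' ?_
  filter_upwards [hf] with n hn
  have h3 : Integrable (fun x => f n x - g x) κ := hn.sub hg
  have h4 : Integrable (fun x => 2 * max (g x - f n x) 0) κ := (hg.sub hn).pos_part.const_mul 2
  rw [← integral_sub hn hg, ← integral_const_mul, ← integral_add h3 h4]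
  refine integral_congr_ae (ae_of_all _ fun x => ?_)
  rcases le_total (f n x) (g x) with h | h
  · simp only [abs_of_nonpos (sub_nonpos.2 h), max_eq_left (sub_nonneg.2 h)]; ring
  · simp only [abs_of_nonneg (sub_nonneg.2 h), max_eq_right (sub_nonpos.2 h)]; ring

section
variable {μ : Measure ℝ≥0} {ν : ℕ → Measure ℝ≥0}

/-- Points of `D` just below and just above the limit quantile trap the approximating quantiles.
Below, the inequality `F(x) < t` is automatically strict; above, only `t ≤ F(x)` is known, and `htD`
makes it strict. -/
lemma tendsto_quantile [IsProbabilityMeasure μ]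
    (hν : ∀ᶠ n in atTop, IsProbabilityMeasure (ν n))
    {D : Set ℝ≥0} (hD : Dense D)
    (hF : ∀ x ∈ D, Tendsto (fun n => cumDist (ν n) x) atTop (𝓝 (cumDist μ x))) {t : ℝ}
    (ht : t < 1) (htD : ∀ x ∈ D, cumDist μ x ≠ t) :
    Tendsto (fun n => quantile (ν n) t) atTop (𝓝 (quantile μ t)) := by
  refine tendsto_order.2 ⟨fun a ha => ?_, fun a ha => ?_⟩
  · obtain ⟨x, hxD, hax, hx⟩ := hD.exists_between ha
    have hlt : cumDist μ x < t := by rwa [← not_le, ← quantile_le_iff μ ht, not_le]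
    filter_upwards [hν, (hF x hxD).eventually_lt_const hlt] with n hn h
    refine hax.trans ?_
    rwa [← not_le, quantile_le_iff _ ht, not_le]
  · obtain ⟨x, hxD, hx, hxa⟩ := hD.exists_between ha
    have hlt : t < cumDist μ x := lt_of_le_of_ne ((quantile_le_iff μ ht x).1 hx.le) (htD x hxD).symm
    filter_upwards [hν, (hF x hxD).eventually_const_lt hlt] with n hn h
    exact ((quantile_le_iff _ ht x).2 h.le).trans_lt hxa

lemma tendsto_dist1 [IsProbabilityMeasure μ]
    (hν : ∀ᶠ n in atTop, IsProbabilityMeasure (ν n))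
    {D : Set ℝ≥0} (hD : Dense D) (hDc : D.Countable)
    (hF : ∀ x ∈ D, Tendsto (fun n => cumDist (ν n) x) atTop (𝓝 (cumDist μ x)))
    (hfin : ∀ᶠ n in atTop, mean (ν n) < ∞) (hμ : mean μ < ∞)
    (hm : Tendsto (fun n => (mean (ν n)).toReal) atTop (𝓝 (mean μ).toReal)) :
    Tendsto (fun n => dist1 (ν n) μ) atTop (𝓝 0) := by
  refine tendsto_integral_abs_sub (fun _ _ => NNReal.coe_nonneg _) (fun _ => NNReal.coe_nonneg _)
    ?_ (integrable_quantile hμ) ?_ ?_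
  · filter_upwards [hν, hfin] with n hn h using integrable_quantile h
  -- The levels excluded in `tendsto_quantile` form a countable, hence null, set.
  · have h1 : ∀ᵐ t ∂unif, t ∉ cumDist μ '' D :=
      (ae_restrict_of_ae ((hDc.image _).ae_notMem volume))
    filter_upwards [h1, ae_restrict_mem measurableSet_Ioo] with t ht ht1
    exact NNReal.tendsto_coe.2 <| tendsto_quantile hν hD hF ht1.2 fun x hx he => ht ⟨x, hx, he⟩
  · rw [integral_quantile]
    refine hm.congr' ?_
    filter_upwards [hν] with n hn
    rw [integral_quantile]

lemma tendsto_of_abs_sub_le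
    (hν : ∀ᶠ n in atTop, IsProbabilityMeasure (ν n))
    (hfin : ∀ᶠ n in atTop, mean (ν n) < ∞)
    (hd : Tendsto (fun n => dist1 (ν n) μ) atTop (𝓝 0))
    {f : Measure ℝ≥0 → ℝ} {c : ℝ}
    (hf : ∀ κ : Measure ℝ≥0, IsProbabilityMeasure κ → mean κ < ∞ →
      |f κ - f μ| ≤ c * dist1 κ μ) :
    Tendsto (fun n => f (ν n)) atTop (𝓝 (f μ)) := by
  rw [tendsto_iff_norm_sub_tendsto_zero]
  refine squeeze_zero' (Eventually.of_forall fun _ => norm_nonneg _) ?_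
    (by simpa using hd.const_mul c)
  filter_upwards [hν, hfin] with n hn h using hf _ hn h

lemma tendsto_toReal_mean [IsProbabilityMeasure μ] (hμ : MemM μ)
    (hν : ∀ᶠ n in atTop, IsProbabilityMeasure (ν n))
    (hfin : ∀ᶠ n in atTop, mean (ν n) < ∞)
    (hd : Tendsto (fun n => dist1 (ν n) μ) atTop (𝓝 0)) :
    Tendsto (fun n => (mean (ν n)).toReal) atTop (𝓝 (mean μ).toReal) :=
  tendsto_of_abs_sub_le hν hfin hd (c := 1) fun κ _ h => by
    simpa using abs_toReal_mean_sub_le h hμ.mean_lt_top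

lemma tendsto_gini [IsProbabilityMeasure μ] (hμ : MemM μ)
    (hν : ∀ᶠ n in atTop, IsProbabilityMeasure (ν n))
    (hfin : ∀ᶠ n in atTop, mean (ν n) < ∞)
    (hd : Tendsto (fun n => dist1 (ν n) μ) atTop (𝓝 0)) :
    Tendsto (fun n => gini (ν n)) atTop (𝓝 (gini μ)) := by
  have hm := ENNReal.toReal_pos hμ.mean_pos.ne' hμ.mean_lt_top.ne
  refine Tendsto.div (tendsto_of_abs_sub_le hν hfin hd (c := 2) (f := fun κ =>
    ∫ z : ℝ≥0 × ℝ≥0, |(z.1 : ℝ) - (z.2 : ℝ)| ∂(κ.prod κ)) fun κ _ h => ?_)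
    ((tendsto_toReal_mean hμ hν hfin hd).const_mul 2) (by positivity)
  exact abs_integral_gini_sub_le h hμ.mean_lt_top

lemma tendsto_hoover [IsProbabilityMeasure μ] (hμ : MemM μ)
    (hν : ∀ᶠ n in atTop, IsProbabilityMeasure (ν n))
    (hfin : ∀ᶠ n in atTop, mean (ν n) < ∞)
    (hd : Tendsto (fun n => dist1 (ν n) μ) atTop (𝓝 0)) :
    Tendsto (fun n => hoover (ν n)) atTop (𝓝 (hoover μ)) := by
  have hm := ENNReal.toReal_pos hμ.mean_pos.ne' hμ.mean_lt_top.ne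
  refine Tendsto.div (tendsto_of_abs_sub_le hν hfin hd (c := 2) (f := fun κ =>
    ∫ x : ℝ≥0, |(x : ℝ) - (mean κ).toReal| ∂κ) fun κ _ h => ?_)
    ((tendsto_toReal_mean hμ hν hfin hd).const_mul 2) (by positivity)
  exact abs_integral_hoover_sub_le h hμ.mean_lt_top

lemma tendsto_W1 [IsProbabilityMeasure μ] (hμ : MemM μ)
    (hν : ∀ᶠ n in atTop, IsProbabilityMeasure (ν n))
    (hfin : ∀ᶠ n in atTop, mean (ν n) < ∞)
    (hd : Tendsto (fun n => dist1 (ν n) μ) atTop (𝓝 0)) :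
    Tendsto (fun n => W1 (ν n) μ) atTop (𝓝 0) := by
  have h := (ENNReal.tendsto_ofReal hd)
  rw [ENNReal.ofReal_zero] at h
  refine h.congr' ?_
  filter_upwards [hν, hfin] with n hn h using (W1_eq_ofReal_dist1 h hμ.mean_lt_top).symm

lemma tendstoUniformlyOn_lorenz [IsProbabilityMeasure μ] (hμ : MemM μ)
    (hν : ∀ᶠ n in atTop, IsProbabilityMeasure (ν n))
    (hfin : ∀ᶠ n in atTop, mean (ν n) < ∞)
    (hd : Tendsto (fun n => dist1 (ν n) μ) atTop (𝓝 0)) :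
    TendstoUniformlyOn (fun n p => lorenz (ν n) p) (lorenz μ) atTop (Set.Icc 0 1) := by
  have hm := ENNReal.toReal_pos hμ.mean_pos.ne' hμ.mean_lt_top.ne
  have hmn := tendsto_toReal_mean hμ hν hfin hd
  set m := (mean μ).toReal
  -- This bound on the Lorenz difference is free of `p`, whence uniformity: the numerators differ by
  -- at most `dist1`, and the limiting numerator is at most `m`.
  have hlim : Tendsto (fun n => dist1 (ν n) μ / (mean (ν n)).toReal +
      m * |(mean (ν n)).toReal⁻¹ - m⁻¹|) atTop (𝓝 0) := by
    have h1 := hd.div hmn hm.ne'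
    have h2 := ((hmn.inv₀ hm.ne').sub_const m⁻¹).abs.const_mul m
    simpa using h1.add h2
  rw [Metric.tendstoUniformlyOn_iff]
  intro ε hε
  filter_upwards [hν, hfin, hlim.eventually_lt_const hε] with n hn hfn hlt p hp
  refine lt_of_le_of_lt ?_ hlt
  rw [dist_comm, Real.dist_eq, lorenz, lorenz, integral_zero_one_quantile,
    integral_zero_one_quantile]
  have hA : |∫ t in (0 : ℝ)..p, (quantile μ t : ℝ)| ≤ m := by
    rw [abs_of_nonneg (intervalIntegral.integral_nonneg hp.1 fun _ _ => NNReal.coe_nonneg _),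
      show m = _ from (integral_zero_one_quantile μ).symm]
    exact intervalIntegral.integral_mono_interval le_rfl hp.1 hp.2
      (ae_of_all _ fun _ => NNReal.coe_nonneg _)
      (intervalIntegrable_quantile hμ.mean_lt_top (by simp) (by simp))
  have hB := abs_integral_quantile_sub_le hfn hμ.mean_lt_top hp
  set A := ∫ t in (0 : ℝ)..p, (quantile μ t : ℝ)
  set B := ∫ t in (0 : ℝ)..p, (quantile (ν n) t : ℝ)
  have hsplit : B / (mean (ν n)).toReal - A / m =
      (B - A) / (mean (ν n)).toReal + A * ((mean (ν n)).toReal⁻¹ - m⁻¹) := by ring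
  rw [hsplit]
  refine (abs_add_le _ _).trans ?_
  rw [abs_div, abs_mul, abs_of_nonneg (a := (mean (ν n)).toReal) ENNReal.toReal_nonneg]
  gcongr
end

/-! ### Empirical measures and the standard estimators. -/

section
variable (x : ℕ → ℝ≥0) {n : ℕ}

lemma isProbabilityMeasure_empirical (hn : 0 < n) : IsProbabilityMeasure (empirical x n) := by
  refine ⟨?_⟩
  have h : (n : ℝ≥0∞) ≠ 0 := by exact_mod_cast hn.ne'
  simp [empirical, ENNReal.inv_mul_cancel h (ENNReal.natCast_ne_top n)]

lemma mean_empirical_lt_top (hn : 0 < n) : mean (empirical x n) < ∞ := by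
  have h : (n : ℝ≥0∞) ≠ 0 := by exact_mod_cast hn.ne'
  rw [mean, empirical, lintegral_smul_measure, lintegral_finsetSum_measure]
  simp only [lintegral_dirac, smul_eq_mul]
  exact ENNReal.mul_lt_top (by simpa [ENNReal.inv_lt_top, pos_iff_ne_zero] using hn.ne')
    (ENNReal.sum_lt_top.2 fun _ _ => ENNReal.coe_lt_top)

lemma integral_empirical (n : ℕ) (f : ℝ≥0 → ℝ) :
    ∫ y, f y ∂(empirical x n) = (∑ i ∈ Finset.range n, f (x i)) / n := by
  rw [empirical, integral_smul_measure, integral_finsetSum_measure fun i _ =>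
      integrable_dirac (by simp)]
  simp [div_eq_inv_mul]

lemma toReal_mean_empirical (n : ℕ) :
    (mean (empirical x n)).toReal = (∑ i ∈ Finset.range n, (x i : ℝ)) / n := by
  rw [toReal_mean, integral_empirical x n fun y => (y : ℝ)]

lemma cumDist_empirical (n : ℕ) (y : ℝ≥0) :
    cumDist (empirical x n) y =
      (∑ i ∈ Finset.range n, (Set.Iic y).indicator (fun _ => (1 : ℝ)) (x i)) / n := by
  rw [← integral_empirical, cumDist, integral_indicator_const _ measurableSet_Iic]
  simp

lemma gini_empirical (hn : 0 < n) : gini (empirical x n) = giniEstimator x n := by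
  have := isProbabilityMeasure_empirical x hn
  have hn' : (n : ℝ) ≠ 0 := by exact_mod_cast hn.ne'
  rw [gini, giniEstimator, integral_prod _ (integrable_abs_sub_prod (mean_empirical_lt_top x hn)),
    integral_empirical, toReal_mean_empirical]
  simp only [integral_empirical x n fun y => |((x _ : ℝ≥0) : ℝ) - (y : ℝ)|]
  rw [← Finset.sum_div]
  set S := ∑ i ∈ Finset.range n, (x i : ℝ)
  rw [div_div, div_div]
  -- Only the denominators remain to be compared, so a vanishing sum `S` needs no separate case.
  congr 1
  field_simp

lemma hoover_empirical (hn : 0 < n) : hoover (empirical x n) = hooverEstimator x n := by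
  have hn' : (n : ℝ) ≠ 0 := by exact_mod_cast hn.ne'
  rw [hoover, hooverEstimator, integral_empirical, toReal_mean_empirical, div_div]
  simp only [one_div, ← div_eq_inv_mul]
  congr 1
  field_simp

/-- Sorting preserves the count of values `≤ y` and gathers them into an initial segment; indices
start at 0, hence `k + 1`. -/
lemma orderStat_le_iff {k : ℕ} (hk : k < n) (y : ℝ≥0) :
    orderStat x n k ≤ y ↔
      k + 1 ≤ (Finset.univ.filter fun j : Fin n => x j ≤ y).card := by
  set σ := Tuple.sort (fun j : Fin n => x j)
  have hmono : Monotone fun j : Fin n => x (σ j) := Tuple.monotone_sort (fun j : Fin n => x j)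
  have hcard : (Finset.univ.filter fun j : Fin n => x j ≤ y).card =
      (Finset.univ.filter fun j : Fin n => x (σ j) ≤ y).card := by
    refine (Finset.card_bij (fun j _ => σ j) ?_ ?_ ?_).symm
    · simp
    · intro a _ b _ h
      exact σ.injective h
    · intro b hb
      exact ⟨σ.symm b, by simpa using hb, by simp⟩
  rw [hcard, orderStat, dif_pos hk]
  refine ⟨fun h => ?_, fun h => ?_⟩
  · have := Finset.card_le_card (s := Finset.Iic (⟨k, hk⟩ : Fin n))
      (t := Finset.univ.filter fun j : Fin n => x (σ j) ≤ y) fun j hj => by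
        simpa using (hmono (Finset.mem_Iic.1 hj)).trans h
    simpa using this
  · by_contra! hlt
    have := Finset.card_le_card (t := Finset.Iio (⟨k, hk⟩ : Fin n))
      (s := Finset.univ.filter fun j : Fin n => x (σ j) ≤ y) fun j hj => by
        rw [Finset.mem_Iio]
        by_contra! hkj
        exact absurd ((hmono hkj).trans (Finset.mem_filter.1 hj).2) (not_le.2 hlt)
    rw [Fin.card_Iio] at this
    simp only at this
    omega

lemma cumDist_empirical_eq_card (y : ℝ≥0) :
    cumDist (empirical x n) y = (Finset.univ.filter fun j : Fin n => x j ≤ y).card / n := by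
  rw [cumDist_empirical, Finset.sum_range]
  simp [Set.indicator_apply]

/-- Both sides have the same upper bounds `y`: as `k < n t < k + 1`, an integer count is `≥ n t`
exactly when it is `≥ k + 1`. -/
lemma quantile_empirical {k : ℕ} (hk : k < n) {t : ℝ}
    (ht : t ∈ Set.Ioo ((k : ℝ) / n) ((k + 1 : ℕ) / n)) :
    quantile (empirical x n) t = orderStat x n k := by
  have hn : 0 < n := by omega
  have := isProbabilityMeasure_empirical x hn
  have hn' : (0 : ℝ) < n := by exact_mod_cast hn
  have ht1 : t < 1 := ht.2.trans_le ((div_le_one hn').2 (by exact_mod_cast hk))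
  refine eq_of_forall_ge_iff fun y => ?_
  rw [quantile_le_iff _ ht1, orderStat_le_iff x hk, cumDist_empirical_eq_card]
  have h1 := (div_lt_iff₀ hn').1 ht.1
  have h2 := (lt_div_iff₀ hn').1 ht.2
  rw [le_div_iff₀ hn']
  refine ⟨fun h => ?_, fun h => h2.le.trans (by exact_mod_cast h)⟩
  have : (k : ℝ) < (Finset.univ.filter fun j : Fin n => x j ≤ y).card := h1.trans_le h
  exact_mod_cast this

lemma integral_quantile_empirical_of_mem {k : ℕ} (hk : k < n) {p : ℝ}
    (hp : p ∈ Set.Icc ((k : ℝ) / n) ((k + 1 : ℕ) / n)) :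
    ∫ t in (k / n : ℝ)..p, (quantile (empirical x n) t : ℝ) =
      (p - k / n) * orderStat x n k := by
  rw [intervalIntegral.integral_of_le hp.1, integral_Ioc_eq_integral_Ioo,
    setIntegral_congr_fun (g := fun _ => (orderStat x n k : ℝ)) measurableSet_Ioo
      fun t ht => by simp only [quantile_empirical x hk ⟨ht.1, ht.2.trans_le hp.2⟩]]
  simp [hp.1]

lemma integral_quantile_empirical_natCast {k : ℕ} (hn : 0 < n) (hk : k ≤ n) :
    ∫ t in (0 : ℝ)..(k / n : ℝ), (quantile (empirical x n) t : ℝ) =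
      (∑ i ∈ Finset.range k, (orderStat x n i : ℝ)) / n := by
  have := isProbabilityMeasure_empirical x hn
  have hn' : (0 : ℝ) < n := by exact_mod_cast hn
  have hmem : ∀ i ≤ n, (i / n : ℝ) ∈ Set.Icc (0 : ℝ) 1 := fun i hi =>
    ⟨by positivity, (div_le_one hn').2 (by exact_mod_cast hi)⟩
  induction k with
  | zero => simp
  | succ k ih =>
    have hle : (k : ℝ) / n ≤ (k + 1 : ℕ) / n := by gcongr; simp
    rw [← intervalIntegral.integral_add_adjacent_intervals
      (intervalIntegrable_quantile (mean_empirical_lt_top x hn) (by simp) (hmem k (by omega)))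
      (intervalIntegrable_quantile (mean_empirical_lt_top x hn) (hmem k (by omega)) (hmem _ hk)),
      ih (by omega), integral_quantile_empirical_of_mem x (by omega) ⟨hle, le_rfl⟩,
      Finset.sum_range_succ]
    push_cast
    field_simp
    ring

lemma integral_quantile_empirical (hn : 0 < n) {p : ℝ} (hp : p ∈ Set.Icc (0 : ℝ) 1) :
    ∫ t in (0 : ℝ)..p, (quantile (empirical x n) t : ℝ) =
      interpSum (fun i => (orderStat x n i : ℝ)) (n * p) / n := by
  have := isProbabilityMeasure_empirical x hn
  have hn' : (0 : ℝ) < n := by exact_mod_cast hn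
  rcases hp.2.eq_or_lt with rfl | hp1
  -- At `p = 1` the floor is `n`, which indexes no cell; the extra term in `interpSum` has weight
  -- zero.
  · have h := integral_quantile_empirical_natCast x hn le_rfl
    rw [div_self hn'.ne'] at h
    simp [h, interpSum]
  · have hnp : 0 ≤ n * p := mul_nonneg hn'.le hp.1
    set k := ⌊n * p⌋₊ with hkdef
    have hk1 : (k : ℝ) ≤ n * p := Nat.floor_le hnp
    have hk2 : n * p < k + 1 := Nat.lt_floor_add_one _
    have hk : k < n := by
      rw [hkdef, Nat.floor_lt hnp]
      exact mul_lt_of_lt_one_right hn' hp1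
    have hmem : p ∈ Set.Icc ((k : ℝ) / n) ((k + 1 : ℕ) / n) := by
      rw [Set.mem_Icc, div_le_iff₀' hn', le_div_iff₀' hn']
      exact ⟨hk1, by exact_mod_cast hk2.le⟩
    have hkmem : (k / n : ℝ) ∈ Set.Icc (0 : ℝ) 1 := ⟨by positivity, hmem.1.trans hp.2⟩
    rw [← intervalIntegral.integral_add_adjacent_intervals
      (intervalIntegrable_quantile (mean_empirical_lt_top x hn) (by simp) hkmem)
      (intervalIntegrable_quantile (mean_empirical_lt_top x hn) hkmem hp),
      integral_quantile_empirical_natCast x hn hk.le, integral_quantile_empirical_of_mem x hk hmem,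
      interpSum, ← hkdef, Finset.sum_range_succ]
    field_simp
    ring

lemma lorenz_empirical (hn : 0 < n) {p : ℝ} (hp : p ∈ Set.Icc (0 : ℝ) 1) :
    lorenz (empirical x n) p = lorenzEstimator x n p := by
  have := isProbabilityMeasure_empirical x hn
  have hn' : (n : ℝ) ≠ 0 := by exact_mod_cast hn.ne'
  rw [lorenz, lorenzEstimator, integral_zero_one_quantile, integral_quantile_empirical x hn hp,
    toReal_mean_empirical, div_div_div_cancel_right₀ hn']
end

/-! ### Almost sure convergence by the strong law. -/

section
variable {Ω : Type*} [MeasurableSpace Ω] {P : Measure Ω}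
  {μ : Measure ℝ≥0} {X : ℕ → Ω → ℝ≥0}

lemma ae_tendsto_average (hX : ∀ i, Measurable (X i)) (hlaw : ∀ i, P.map (X i) = μ)
    (hindep : iIndepFun X P) {f : ℝ≥0 → ℝ} (hf : Measurable f) (hint : Integrable f μ) :
    ∀ᵐ ω ∂P, Tendsto (fun n : ℕ => (∑ i ∈ Finset.range n, f (X i ω)) / n) atTop
      (𝓝 (∫ y, f y ∂μ)) := by
  have h := strong_law_ae_real (μ := P) (fun i ω => f (X i ω))
    (by rw [← hlaw 0] at hint; exact hint.comp_measurable (hX 0))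
    (fun i j hij => (hindep.indepFun hij).comp hf hf)
    (fun i => IdentDistrib.comp
      ⟨(hX i).aemeasurable, (hX 0).aemeasurable, by rw [hlaw, hlaw]⟩ hf)
  rwa [← integral_map (hX 0).aemeasurable hf.aestronglyMeasurable, hlaw] at h

lemma ae_tendsto_dist1_empirical (hμ : MemM μ) (hX : ∀ i, Measurable (X i))
    (hlaw : ∀ i, P.map (X i) = μ) (hindep : iIndepFun X P) :
    ∀ᵐ ω ∂P, Tendsto (fun n => dist1 (empirical (fun i => X i ω) n) μ) atTop (𝓝 0) := by
  have := hμ.isProbabilityMeasure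
  obtain ⟨D, hDc, hD⟩ := TopologicalSpace.exists_countable_dense ℝ≥0
  have hF : ∀ᵐ ω ∂P, ∀ y ∈ D,
      Tendsto (fun n => cumDist (empirical (fun i => X i ω) n) y) atTop (𝓝 (cumDist μ y)) := by
    -- Countability of `D` gives one null set for all `y ∈ D`.
    refine (ae_ball_iff hDc).2 fun y _ => ?_
    have h := ae_tendsto_average hX hlaw hindep
      (f := (Set.Iic y).indicator fun _ => (1 : ℝ))
      (measurable_const.indicator measurableSet_Iic)
      ((integrable_const _).indicator measurableSet_Iic)
    filter_upwards [h] with ω hω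
    rw [integral_indicator_const _ measurableSet_Iic, smul_eq_mul, mul_one] at hω
    change Tendsto _ _ (𝓝 (cumDist μ y)) at hω
    simpa only [cumDist_empirical] using hω
  filter_upwards [hF, ae_tendsto_average hX hlaw hindep measurable_coe_nnreal_real
    (integrable_coe hμ.mean_lt_top)] with ω h1 h2
  refine tendsto_dist1 ?_ hD hDc h1 ?_ hμ.mean_lt_top ?_
  · filter_upwards [eventually_gt_atTop 0] with n hn using isProbabilityMeasure_empirical _ hn
  · filter_upwards [eventually_gt_atTop 0] with n hn using mean_empirical_lt_top _ hn
  · simpa only [toReal_mean_empirical, toReal_mean μ] using h2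
end

end Wealth

theorem mainTheorem10 {Ω : Type*} [MeasurableSpace Ω] (P : Measure Ω) [IsProbabilityMeasure P]
    (μ : Measure ℝ≥0) (hμ : Wealth.MemM μ)
    (X : ℕ → Ω → ℝ≥0) (hX : ∀ i, Measurable (X i)) (hlaw : ∀ i, P.map (X i) = μ)
    (hindep : iIndepFun X P) :
    -- almost sure convergence of the empirical measures and of their indicators
    (∀ᵐ ω ∂P,
      (∀ᶠ n in atTop, Wealth.MemM (Wealth.empirical (fun i => X i ω) n)) ∧
      Tendsto (fun n => Wealth.W1 (Wealth.empirical (fun i => X i ω) n) μ) atTop (𝓝 0) ∧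
      TendstoUniformlyOn (fun n p => Wealth.lorenz (Wealth.empirical (fun i => X i ω) n) p)
        (Wealth.lorenz μ) atTop (Set.Icc 0 1) ∧
      Tendsto (fun n => Wealth.gini (Wealth.empirical (fun i => X i ω) n)) atTop
        (𝓝 (Wealth.gini μ)) ∧
      Tendsto (fun n => Wealth.hoover (Wealth.empirical (fun i => X i ω) n)) atTop
        (𝓝 (Wealth.hoover μ))) ∧
    -- the standard estimators are the indicators of the empirical measures
    (∀ ω, ∀ n : ℕ, 0 < n →
      Wealth.gini (Wealth.empirical (fun i => X i ω) n) =
        Wealth.giniEstimator (fun i => X i ω) n ∧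
      Wealth.hoover (Wealth.empirical (fun i => X i ω) n) =
        Wealth.hooverEstimator (fun i => X i ω) n ∧
      ∀ p ∈ Set.Icc (0 : ℝ) 1, Wealth.lorenz (Wealth.empirical (fun i => X i ω) n) p =
        Wealth.lorenzEstimator (fun i => X i ω) n p) ∧
    -- strong consistency of the standard estimators
    (∀ᵐ ω ∂P,
      Tendsto (fun n => Wealth.giniEstimator (fun i => X i ω) n) atTop (𝓝 (Wealth.gini μ)) ∧
      Tendsto (fun n => Wealth.hooverEstimator (fun i => X i ω) n) atTop
        (𝓝 (Wealth.hoover μ)) ∧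
      TendstoUniformlyOn (fun n p => Wealth.lorenzEstimator (fun i => X i ω) n p)
        (Wealth.lorenz μ) atTop (Set.Icc 0 1)) := by
  have := hμ.isProbabilityMeasure
  have hlim : ∀ᵐ ω ∂P,
      (∀ᶠ n in atTop, Wealth.MemM (Wealth.empirical (fun i => X i ω) n)) ∧
      Tendsto (fun n => Wealth.W1 (Wealth.empirical (fun i => X i ω) n) μ) atTop (𝓝 0) ∧
      TendstoUniformlyOn (fun n p => Wealth.lorenz (Wealth.empirical (fun i => X i ω) n) p)
        (Wealth.lorenz μ) atTop (Set.Icc 0 1) ∧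
      Tendsto (fun n => Wealth.gini (Wealth.empirical (fun i => X i ω) n)) atTop
        (𝓝 (Wealth.gini μ)) ∧
      Tendsto (fun n => Wealth.hoover (Wealth.empirical (fun i => X i ω) n)) atTop
        (𝓝 (Wealth.hoover μ)) := by
    filter_upwards [Wealth.ae_tendsto_dist1_empirical hμ hX hlaw hindep] with ω hd
    have hp : ∀ᶠ n in atTop, IsProbabilityMeasure (Wealth.empirical (fun i => X i ω) n) := by
      filter_upwards [eventually_gt_atTop 0] with n hn
      exact Wealth.isProbabilityMeasure_empirical _ hn
    have hfin : ∀ᶠ n in atTop, Wealth.mean (Wealth.empirical (fun i => X i ω) n) < ∞ := by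
      filter_upwards [eventually_gt_atTop 0] with n hn using Wealth.mean_empirical_lt_top _ hn
    have hM : ∀ᶠ n in atTop, Wealth.MemM (Wealth.empirical (fun i => X i ω) n) := by
      -- The empirical means converge to a positive limit, so they are eventually positive.
      filter_upwards [hp, hfin, (Wealth.tendsto_toReal_mean hμ hp hfin hd).eventually_const_lt
        (ENNReal.toReal_pos hμ.mean_pos.ne' hμ.mean_lt_top.ne)] with n h1 h2 h3
      exact ⟨h1, (ENNReal.toReal_pos_iff.1 h3).1, h2⟩
    exact And.intro hM <| And.intro (Wealth.tendsto_W1 hμ hp hfin hd) <|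
      And.intro (Wealth.tendstoUniformlyOn_lorenz hμ hp hfin hd) <|
      And.intro (Wealth.tendsto_gini hμ hp hfin hd) (Wealth.tendsto_hoover hμ hp hfin hd)
  refine ⟨hlim, fun ω n hn => ⟨Wealth.gini_empirical _ hn, Wealth.hoover_empirical _ hn,
    fun p hp => Wealth.lorenz_empirical _ hn hp⟩, ?_⟩
  filter_upwards [hlim] with ω h
  refine ⟨h.2.2.2.1.congr' ?_, h.2.2.2.2.congr' ?_, h.2.2.1.congr ?_⟩
  · filter_upwards [eventually_gt_atTop 0] with n hn using Wealth.gini_empirical _ hn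
  · filter_upwards [eventually_gt_atTop 0] with n hn using Wealth.hoover_empirical _ hn
  · filter_upwards [eventually_gt_atTop 0] with n hn p hp using Wealth.lorenz_empirical _ hn hp
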